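/- **Setting.** Let $(\mathcal X,d)$ be a Polish metric space with its Borel $\sigma$-algebra and let $\lambda>0$. For probability measures $\mu,\nu$ on $\mathcal X$ let $$W^{(\lambda)}(\mu,\nu)=\inf_{\pi\in\Pi(\mu,\nu)}\int_{\mathcal X\times\mathcal X}\min\{d(x,y),2\lambda\}\,d\pi(x,y),$$ where $\Pi(\mu,\nu)$ is the set of couplings of $\mu$ and $\nu$. Let $X_1,X_2,\dots$ be $\mathcal X$-valued random variables on a probability space $(\Omega,\mathcal F,\mathrm P)$, let $\hat\mu_n=\frac1n\sum_{i=1}^n\delta_{X_i}$, and let $\mu_\star$ be a probability measure on $\mathcal X$. Let $\Theta\subset\mathbb R^{d_\theta}$ be non-empty, with a distance $\rho_\Theta$ that induces the usual topology of $\Theta$. For $\theta\in\Theta$ let $\mu_\theta$ be a probability measure on $\mathcal X$ and, for each $m\ge1$, let $\mu_\theta^{(m)}$ be a probability measure on $\mathcal X^m$ under which $Z_{1:m}=(Z_1,\dots,Z_m)$ has identically distributed coordinates, each of law $\mu_\theta$ (for instance $\mu_\theta^{(m)}=\mu_\theta^{\otimes m}$, the i.i.d. model). Let $\hat\mu_{\theta,m}=\frac1m\sum_{i=1}^m\delta_{Z_i}$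 with $Z_{1:m}\sim\mu_\theta^{(m)}$, and let $\mathrm E_m$ be the expectation over $Z_{1:m}$. Let $m(n)$ be positive integers with $m(n)\to\infty$ as $n\to\infty$. **Assumptions.** 1. $W^{(\lambda)}(\hat\mu_n,\mu_\star)\to0$ $\mathrm P$-almost surely as $n\to\infty$. 2. If $\rho_\Theta(\theta_n,\theta)\to0$, then $\mu_{\theta_n}\to\mu_\theta$ weakly. 3. For some $\varepsilon>0$ the set $B_\star(\varepsilon)=\{\theta\in\Theta: W^{(\lambda)}(\mu_\star,\mu_\theta)\le\varepsilon_\star+\varepsilon\}$, with $\varepsilon_\star=\inf_{\theta\in\Theta}W^{(\lambda)}(\mu_\star,\mu_\theta)$, is bounded and its closure in $\mathbb R^{d_\theta}$ is contained in $\Theta$ (the latter is automatic if $\Theta$ is closed). 4. For every $m\ge1$, if $\rho_\Theta(\theta_n,\theta)\to0$, then $\mu^{(m)}_{\theta_n}\to\mu^{(m)}_\theta$ weakly as $n\to\infty$. 5. If $\rho_\Theta(\theta_n,\theta)\to0$, then $\mathrm E_n\,W^{(\lambda)}(\mu_{\theta_n},\hat\mu_{\theta_n,n})\to0$ as $n\to\infty$.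 **Theorem 8 (Existence of MERWE).** Under Assumptions 1–5 there is a measurable set $\mathcal A\subset\Omega$ with $\mathrm P(\mathcal A)=1$ such that, for all $\omega\in\mathcal A$, $$\inf_{\theta\in\Theta}\mathrm E_{m(n)}\big[W^{(\lambda)}(\hat\mu_n(\omega),\hat\mu_{\theta,m(n)})\big]\to\inf_{\theta\in\Theta}W^{(\lambda)}(\mu_\star,\mu_\theta)\qquad(n\to\infty),$$ there is $n(\omega)$ such that the sets $\operatorname{argmin}_{\theta\in\Theta}\mathrm E_{m(n)}[W^{(\lambda)}(\hat\mu_n(\omega),\hat\mu_{\theta,m(n)})]$ are non-empty for all $n\ge n(\omega)$ and their union over $n\ge n(\omega)$ is bounded, and $$\limsup_{n\to\infty}\operatorname*{argmin}_{\theta\in\Theta}\mathrm E_{m(n)}\big[W^{(\lambda)}(\hat\mu_n(\omega),\hat\mu_{\theta,m(n)})\big]\subset\operatorname*{argmin}_{\theta\in\Theta}W^{(\lambda)}(\mu_\star,\mu_\theta),$$ where the limsup of a sequence of sets is the set of all limits of sequences of points chosen from a subsequence of the sets (the outer limit in the sense of Painlevé–Kuratowski). -/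

import Mathlib

open MeasureTheory Filter Topology

noncomputable section

/-- The robust Wasserstein distance with trimmed cost `min (d x y) (2 * lam)`: the infimum of the
transport cost over all couplings `π` of `μ` and `ν`. It is used for probability measures only; the
cost is bounded and measurable on a second countable space, so every integral below is a genuine
one. -/
def robustWasserstein {𝒳 : Type*} [MetricSpace 𝒳] [MeasurableSpace 𝒳]
    (lam : ℝ) (μ ν : Measure 𝒳) : ℝ :=
  sInf {r : ℝ | ∃ π : Measure (𝒳 × 𝒳), π.fst = μ ∧ π.snd = ν ∧
    r = ∫ p, min (dist p.1 p.2) (2 * lam) ∂π}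

/-- The empirical measure `n⁻¹ ∑ δ_{x i}` of a sample of size `n` (a probability measure as soon as
`1 ≤ n`). -/
def empiricalMeasure {𝒳 : Type*} [MeasurableSpace 𝒳] {n : ℕ} (x : Fin n → 𝒳) : Measure 𝒳 :=
  (n : ENNReal)⁻¹ • ∑ i, Measure.dirac (x i)

/-- `E [W(ν, μ̂_m)]`, where `μ̂_m` is the empirical measure of a sample `z` of size `m` with joint
law `Q`. On a Polish space and for `1 ≤ m` the integrand is bounded and continuous in `z`. -/
def expectedRobustWasserstein {𝒳 : Type*} [MetricSpace 𝒳] [MeasurableSpace 𝒳]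
    (lam : ℝ) (ν : Measure 𝒳) {m : ℕ} (Q : Measure (Fin m → 𝒳)) : ℝ :=
  ∫ z, robustWasserstein lam ν (empiricalMeasure z) ∂Q

/-- The set of minimizers over `Θ` of `f : Θ → ℝ`, as a subset of the ambient space. -/
def argminSet {E : Type*} {Θ : Set E} (f : Θ → ℝ) : Set E :=
  {x | ∃ θ : Θ, (θ : E) = x ∧ ∀ θ' : Θ, f θ ≤ f θ'}

/-- The set of `ε`-minimizers over `Θ` of `f : Θ → ℝ`, as a subset of the ambient space. -/
def nearArgminSet {E : Type*} {Θ : Set E} (f : Θ → ℝ) (ε : ℝ) : Set E :=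
  {x | ∃ θ : Θ, (θ : E) = x ∧ f θ ≤ (⨅ θ' : Θ, f θ') + ε}

/-- The outer limit (limit superior in the sense of Painlevé–Kuratowski) of a sequence of sets:
all limits of sequences of points chosen from a subsequence of the sets. -/
def outerLimit {E : Type*} [TopologicalSpace E] (C : ℕ → Set E) : Set E :=
  {x | ∃ φ : ℕ → ℕ, StrictMono φ ∧ ∃ y : ℕ → E, (∀ k, y k ∈ C (φ k)) ∧ Tendsto y atTop (𝓝 x)}

end

/-! Write F_n for the empirical objective, f for its limit and a_n for the distance from the data's
empirical measure to `μstar`. Two facts replace uniform convergence of F_n to f, which may fail on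
an unbounded Θ. From below, Jensen's inequality (`robustWasserstein_le_expectedRobustWasserstein`)
and the triangle inequality give F_n ≥ f - a_n uniformly in θ. Locally, F_n converges continuously:
F_n(θ_n) → f(θ) whenever θ_n → θ. The lower bound eventually traps minimizers in a near-argmin set
of f, whose closure is compact and lies in Θ; continuity of F_n then gives existence, and continuous
convergence identifies the cluster points (`tendsto_iInf_and_argminSet`).

The two facts on measures, Jensen's inequality and weak convergence implying W-convergence, both
rest on rounding the space to countably many points (`exists_discretization`). This removes
measurable selection from the first and reduces the second to convergence of the masses of atoms. -/

namespace RobustWasserstein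

open ProbabilityTheory

/-! ### The trimmed cost as a bounded continuous metric -/

section Cost

variable {𝒳 : Type*} [MetricSpace 𝒳] {lam : ℝ}

/-- The trimmed cost `min (d x y) (2 * lam)`. -/
def trimmedCost (lam : ℝ) (p : 𝒳 × 𝒳) : ℝ := min (dist p.1 p.2) (2 * lam)

lemma trimmedCost_nonneg (hlam : 0 < lam) (p : 𝒳 × 𝒳) : 0 ≤ trimmedCost lam p :=
  le_min dist_nonneg (by positivity)

lemma trimmedCost_le_bound (p : 𝒳 × 𝒳) : trimmedCost lam p ≤ 2 * lam := min_le_right _ _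

lemma trimmedCost_le_dist (p : 𝒳 × 𝒳) : trimmedCost lam p ≤ dist p.1 p.2 := min_le_left _ _

lemma trimmedCost_swap (p : 𝒳 × 𝒳) : trimmedCost lam p.swap = trimmedCost lam p := by
  simp [trimmedCost, dist_comm]

lemma trimmedCost_self (hlam : 0 < lam) (x : 𝒳) : trimmedCost lam (x, x) = 0 := by
  simp [trimmedCost, hlam.le]

lemma trimmedCost_triangle (hlam : 0 < lam) (x y z : 𝒳) :
    trimmedCost lam (x, z) ≤ trimmedCost lam (x, y) + trimmedCost lam (y, z) := by
  have := dist_triangle x y z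
  have h1 : 0 ≤ dist x y := dist_nonneg
  have h2 : 0 ≤ dist y z := dist_nonneg
  simp only [trimmedCost]
  rcases min_cases (dist x y) (2 * lam) with h | h <;>
  rcases min_cases (dist y z) (2 * lam) with h' | h' <;>
  rcases min_cases (dist x z) (2 * lam) with h'' | h'' <;> linarith

lemma continuous_trimmedCost : Continuous (trimmedCost lam : 𝒳 × 𝒳 → ℝ) := by
  unfold trimmedCost; fun_prop

variable [SecondCountableTopology 𝒳] [MeasurableSpace 𝒳] [BorelSpace 𝒳]

lemma measurable_trimmedCost : Measurable (trimmedCost lam : 𝒳 × 𝒳 → ℝ) :=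
  continuous_trimmedCost.measurable

lemma integrable_trimmedCost_comp {α : Type*} [MeasurableSpace α] (hlam : 0 < lam)
    (μ : Measure α) [IsFiniteMeasure μ] {g : α → 𝒳 × 𝒳} (hg : Measurable g) :
    Integrable (fun a => trimmedCost lam (g a)) μ :=
  Integrable.of_bound (measurable_trimmedCost.comp hg).aestronglyMeasurable (2 * lam)
    (ae_of_all _ fun a => by
      rw [Real.norm_of_nonneg (trimmedCost_nonneg hlam _)]; exact trimmedCost_le_bound _)

lemma integrable_trimmedCost (hlam : 0 < lam) (π : Measure (𝒳 × 𝒳)) [IsFiniteMeasure π] :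
    Integrable (trimmedCost lam) π :=
  integrable_trimmedCost_comp hlam π measurable_id

end Cost

/-! ### Elementary bounds from explicit couplings -/

section Coupling

variable {𝒳 : Type*} [MetricSpace 𝒳] [MeasurableSpace 𝒳] {lam : ℝ}

lemma robustWasserstein_nonneg (hlam : 0 < lam) (μ ν : Measure 𝒳) :
    0 ≤ robustWasserstein lam μ ν := by
  refine Real.sInf_nonneg ?_
  rintro _ ⟨π, -, -, rfl⟩
  exact integral_nonneg (trimmedCost_nonneg hlam)

lemma robustWasserstein_le_integral (hlam : 0 < lam) {μ ν : Measure 𝒳} {π : Measure (𝒳 × 𝒳)}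
    (h₁ : π.fst = μ) (h₂ : π.snd = ν) :
    robustWasserstein lam μ ν ≤ ∫ p, trimmedCost lam p ∂π := by
  refine csInf_le ⟨0, ?_⟩ ⟨π, h₁, h₂, rfl⟩
  rintro _ ⟨π, -, -, rfl⟩
  exact integral_nonneg (trimmedCost_nonneg hlam)

/-- The product coupling makes the infimum one over a non-empty set. Near-optimal couplings suffice
throughout; optimal ones are never needed. -/
lemma exists_coupling_integral_lt {μ ν : Measure 𝒳} [IsProbabilityMeasure μ]
    [IsProbabilityMeasure ν] {r : ℝ} (h : robustWasserstein lam μ ν < r) :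
    ∃ π : Measure (𝒳 × 𝒳), IsProbabilityMeasure π ∧ π.fst = μ ∧ π.snd = ν ∧
      ∫ p, trimmedCost lam p ∂π < r := by
  obtain ⟨_, ⟨π, h₁, h₂, rfl⟩, hr⟩ :=
    exists_lt_of_csInf_lt (by exact ⟨_, μ.prod ν, by simp, by simp, rfl⟩) h
  refine ⟨π, ⟨?_⟩, h₁, h₂, hr⟩
  rw [← Measure.fst_univ, h₁, measure_univ]

variable [SecondCountableTopology 𝒳] [BorelSpace 𝒳]

lemma robustWasserstein_comm_le (hlam : 0 < lam) (μ ν : Measure 𝒳) [IsProbabilityMeasure μ]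
    [IsProbabilityMeasure ν] : robustWasserstein lam μ ν ≤ robustWasserstein lam ν μ := by
  refine le_of_forall_pos_lt_add fun ε hε => ?_
  obtain ⟨π, -, h₁, h₂, hr⟩ := exists_coupling_integral_lt (lam := lam) (lt_add_of_pos_right
    (robustWasserstein lam ν μ) hε)
  refine (robustWasserstein_le_integral hlam (π := π.map Prod.swap) ?_ ?_).trans_lt ?_
  · rw [Measure.fst_map_swap, h₂]
  · rw [Measure.snd_map_swap, h₁]
  · rw [integral_map measurable_swap.aemeasurable measurable_trimmedCost.aestronglyMeasurable]
    simpa only [trimmedCost_swap] using hr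

lemma robustWasserstein_comm (hlam : 0 < lam) (μ ν : Measure 𝒳) [IsProbabilityMeasure μ]
    [IsProbabilityMeasure ν] : robustWasserstein lam μ ν = robustWasserstein lam ν μ :=
  le_antisymm (robustWasserstein_comm_le hlam μ ν) (robustWasserstein_comm_le hlam ν μ)

lemma robustWasserstein_le_bound (hlam : 0 < lam) (μ ν : Measure 𝒳) [IsProbabilityMeasure μ]
    [IsProbabilityMeasure ν] : robustWasserstein lam μ ν ≤ 2 * lam := by
  refine (robustWasserstein_le_integral hlam (π := μ.prod ν) (by simp) (by simp)).trans ?_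
  calc ∫ p, trimmedCost lam p ∂μ.prod ν ≤ ∫ _, 2 * lam ∂μ.prod ν :=
        integral_mono (integrable_trimmedCost hlam _) (integrable_const _) trimmedCost_le_bound
    _ = 2 * lam := by simp

/-- Two random variables that are always within `δ` of each other have close laws. -/
lemma robustWasserstein_map_le {α : Type*} [MeasurableSpace α] (hlam : 0 < lam)
    (μ : Measure α) [IsProbabilityMeasure μ] {g h : α → 𝒳} (hg : Measurable g)
    (hh : Measurable h) {δ : ℝ} (hδ : ∀ a, dist (g a) (h a) ≤ δ) :
    robustWasserstein lam (μ.map g) (μ.map h) ≤ δ := by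
  refine (robustWasserstein_le_integral hlam (π := μ.map fun a => (g a, h a)) ?_ ?_).trans ?_
  · rw [Measure.fst_map_prodMk hh]
  · rw [Measure.snd_map_prodMk hg]
  · rw [integral_map (hg.prodMk hh).aemeasurable measurable_trimmedCost.aestronglyMeasurable]
    calc ∫ a, trimmedCost lam (g a, h a) ∂μ ≤ ∫ _, δ ∂μ :=
          integral_mono (integrable_trimmedCost_comp hlam μ (hg.prodMk hh)) (integrable_const _)
            fun a => (trimmedCost_le_dist _).trans (hδ a)
      _ = δ := by simp

/-- Convexity of the robust Wasserstein distance along mixtures of couplings. -/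
lemma robustWasserstein_bind_le {α : Type*} [MeasurableSpace α] (hlam : 0 < lam)
    (Q : Measure α) [IsProbabilityMeasure Q] (κ : Kernel α (𝒳 × 𝒳)) [IsMarkovKernel κ] :
    robustWasserstein lam (Q.bind (Kernel.fst κ)) (Q.bind (Kernel.snd κ)) ≤
      ∫ a, ∫ p, trimmedCost lam p ∂κ a ∂Q := by
  refine (robustWasserstein_le_integral hlam (π := Q.bind κ) ?_ ?_).trans_eq ?_
  · ext s hs
    rw [Measure.fst_apply hs, Measure.bind_apply (measurable_fst hs) κ.aemeasurable,
      Measure.bind_apply hs (Kernel.fst κ).aemeasurable]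
    simp [Kernel.fst_apply' κ _ hs, Set.preimage]
  · ext s hs
    rw [Measure.snd_apply hs, Measure.bind_apply (measurable_snd hs) κ.aemeasurable,
      Measure.bind_apply hs (Kernel.snd κ).aemeasurable]
    simp [Kernel.snd_apply' κ _ hs, Set.preimage]
  · rw [← Measure.snd_compProd, Measure.snd, integral_map measurable_snd.aemeasurable
      measurable_trimmedCost.aestronglyMeasurable, Measure.integral_compProd
      (integrable_trimmedCost_comp hlam _ measurable_snd)]

end Coupling

/-! ### Gluing and the triangle inequality -/

section Triangle

/-- The gluing lemma. -/
lemma exists_gluing {𝒴 : Type*} [MeasurableSpace 𝒴] [StandardBorelSpace 𝒴] [Nonempty 𝒴]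
    (π₁ π₂ : Measure (𝒴 × 𝒴)) [IsFiniteMeasure π₁] [IsFiniteMeasure π₂]
    (h : π₁.snd = π₂.fst) :
    ∃ γ : Measure (𝒴 × 𝒴 × 𝒴), γ.map (fun p => (p.2.1, p.1)) = π₁ ∧
      γ.map (fun p => (p.1, p.2.2)) = π₂ := by
  set ρ := π₁.map Prod.swap with hρ
  have hρfst : ρ.fst = π₂.fst := by rw [hρ, Measure.fst_map_swap, h]
  have key (η : Kernel 𝒴 (𝒴 × 𝒴)) [IsSFiniteKernel η] {f : 𝒴 × 𝒴 → 𝒴} (hf : Measurable f) :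
      (π₂.fst ⊗ₘ η).map (fun p => (p.1, f p.2)) = π₂.fst ⊗ₘ (η.map f) := by
    rw [Measure.compProd_map hf]; rfl
  -- The shared coordinate is drawn first; given it, the outer two are drawn independently from
  -- their conditional laws.
  refine ⟨π₂.fst ⊗ₘ (ρ.condKernel ×ₖ π₂.condKernel), ?_, ?_⟩
  · have h1 := key (ρ.condKernel ×ₖ π₂.condKernel) measurable_fst
    rw [← Kernel.fst_eq, Kernel.fst_prod, ← hρfst, ρ.disintegrate, hρfst] at h1
    have : (fun p : 𝒴 × 𝒴 × 𝒴 => (p.2.1, p.1)) = Prod.swap ∘ fun p => (p.1, p.2.1) := rfl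
    rw [this, ← Measure.map_map measurable_swap (by fun_prop), h1, hρ,
      Measure.map_map measurable_swap measurable_swap]
    simp
  · rw [key _ measurable_snd, ← Kernel.snd_eq, Kernel.snd_prod, π₂.disintegrate]

variable {𝒳 : Type*} [MetricSpace 𝒳] [PolishSpace 𝒳] [MeasurableSpace 𝒳] [BorelSpace 𝒳]
  {lam : ℝ}

lemma robustWasserstein_triangle (hlam : 0 < lam) (μ ν ρ : Measure 𝒳)
    [IsProbabilityMeasure μ] [IsProbabilityMeasure ν] [IsProbabilityMeasure ρ] :
    robustWasserstein lam μ ρ ≤ robustWasserstein lam μ ν + robustWasserstein lam ν ρ := by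
  have : Nonempty 𝒳 := nonempty_of_isProbabilityMeasure μ
  refine le_of_forall_pos_lt_add fun ε hε => ?_
  obtain ⟨π₁, _, h₁, h₂, hr⟩ := exists_coupling_integral_lt (lam := lam) (lt_add_of_pos_right
    (robustWasserstein lam μ ν) (half_pos hε))
  obtain ⟨π₂, _, h₃, h₄, hs⟩ := exists_coupling_integral_lt (lam := lam) (lt_add_of_pos_right
    (robustWasserstein lam ν ρ) (half_pos hε))
  obtain ⟨γ, hγ₁, hγ₂⟩ := exists_gluing π₁ π₂ (h₂.trans h₃.symm)
  have : IsProbabilityMeasure (γ.map fun p : 𝒳 × 𝒳 × 𝒳 => (p.1, p.2.2)) := hγ₂ ▸ ‹_›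
  have : IsProbabilityMeasure γ := Measure.isProbabilityMeasure_of_map
    (fun p : 𝒳 × 𝒳 × 𝒳 => (p.1, p.2.2))
  have hm₁ : Measurable fun p : 𝒳 × 𝒳 × 𝒳 => (p.2.1, p.1) := by fun_prop
  have hm₂ : Measurable fun p : 𝒳 × 𝒳 × 𝒳 => (p.1, p.2.2) := by fun_prop
  have hm₃ : Measurable fun p : 𝒳 × 𝒳 × 𝒳 => (p.2.1, p.2.2) := by fun_prop
  refine (robustWasserstein_le_integral hlam
    (π := γ.map fun p : 𝒳 × 𝒳 × 𝒳 => (p.2.1, p.2.2)) ?_ ?_).trans_lt ?_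
  · rw [← h₁, ← hγ₁, Measure.fst_map_prodMk (by fun_prop), Measure.fst_map_prodMk (by fun_prop)]
  · rw [← h₄, ← hγ₂, Measure.snd_map_prodMk (by fun_prop), Measure.snd_map_prodMk (by fun_prop)]
  · rw [integral_map hm₃.aemeasurable measurable_trimmedCost.aestronglyMeasurable]
    rw [← hγ₁, integral_map hm₁.aemeasurable measurable_trimmedCost.aestronglyMeasurable] at hr
    rw [← hγ₂, integral_map hm₂.aemeasurable measurable_trimmedCost.aestronglyMeasurable] at hs
    have h := integral_mono (integrable_trimmedCost_comp hlam γ hm₃)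
      ((integrable_trimmedCost_comp hlam γ hm₁).add (integrable_trimmedCost_comp hlam γ hm₂))
      fun p => trimmedCost_triangle hlam p.2.1 p.1 p.2.2
    have h' := integral_add (integrable_trimmedCost_comp hlam γ hm₁)
      (integrable_trimmedCost_comp hlam γ hm₂)
    simp only [Pi.add_apply] at h
    linarith

end Triangle

/-! ### Empirical measures -/

section Empirical

variable {𝒳 : Type*} [MeasurableSpace 𝒳]

lemma isProbabilityMeasure_empiricalMeasure {n : ℕ} (hn : 1 ≤ n) (x : Fin n → 𝒳) :
    IsProbabilityMeasure (empiricalMeasure x) := by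
  constructor
  have : (n : ENNReal) ≠ 0 := by exact_mod_cast (by omega : n ≠ 0)
  simp [empiricalMeasure, ENNReal.inv_mul_cancel this]

/-- Seen as images of the uniform law on indices, two samples of equal size are coupled index by
index. -/
lemma empiricalMeasure_eq_map {n : ℕ} (x : Fin n → 𝒳) :
    empiricalMeasure x = (empiricalMeasure (id : Fin n → Fin n)).map x := by
  rw [empiricalMeasure, empiricalMeasure, Measure.map_smul,
    Measure.map_finset_sum Measurable.of_discrete.aemeasurable]
  simp [Measure.map_dirac' (Measurable.of_discrete (f := x))]

/-- By linearity only the one-dimensional marginals enter; independence plays no role. -/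
lemma lintegral_empiricalMeasure_apply {n : ℕ} (hn : 1 ≤ n) {Q : Measure (Fin n → 𝒳)}
    {μ : Measure 𝒳} (hQ : ∀ i, Q.map (fun z => z i) = μ) {s : Set 𝒳} (hs : MeasurableSet s) :
    ∫⁻ z, empiricalMeasure z s ∂Q = μ s := by
  have hn' : (n : ENNReal) ≠ 0 := by exact_mod_cast (by omega : n ≠ 0)
  have h (i : Fin n) : ∫⁻ z : Fin n → 𝒳, Measure.dirac (z i) s ∂Q = μ s := by
    rw [← hQ i, Measure.map_apply (measurable_pi_apply i) hs,
      ← lintegral_indicator_one (measurable_pi_apply i hs)]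
    simp only [Measure.dirac_apply' _ hs]
    rfl
  have hmeas (i : Fin n) : Measurable fun z : Fin n → 𝒳 => Measure.dirac (z i) s :=
    (Measure.measurable_coe hs).comp (Measure.measurable_dirac.comp (measurable_pi_apply i))
  simp only [empiricalMeasure, Measure.smul_apply, Measure.finsetSum_apply, smul_eq_mul]
  rw [lintegral_const_mul _ (Finset.measurable_sum _ fun i _ => hmeas i),
    lintegral_finsetSum _ fun i _ => hmeas i]
  simp [h, ← mul_assoc, ENNReal.inv_mul_cancel hn']

end Empirical

/-! ### Discretization, Jensen's inequality and weak convergence -/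

section WeakConvergence

variable {𝒳 : Type*} [MetricSpace 𝒳] [PolishSpace 𝒳] [MeasurableSpace 𝒳] [BorelSpace 𝒳]
  {lam : ℝ}

lemma robustWasserstein_empiricalMeasure_le (hlam : 0 < lam) {n : ℕ} (hn : 1 ≤ n)
    {x y : Fin n → 𝒳} {δ : ℝ} (h : ∀ i, dist (x i) (y i) ≤ δ) :
    robustWasserstein lam (empiricalMeasure x) (empiricalMeasure y) ≤ δ := by
  have := isProbabilityMeasure_empiricalMeasure hn (id : Fin n → Fin n)
  rw [empiricalMeasure_eq_map x, empiricalMeasure_eq_map y]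
  exact robustWasserstein_map_le hlam _ .of_discrete .of_discrete h

/-- Matching the samples index by index costs at most their sup distance. This makes the integrand
of the objective a bounded continuous test function. -/
lemma lipschitzWith_robustWasserstein_empiricalMeasure (hlam : 0 < lam) {n : ℕ} (hn : 1 ≤ n)
    (ν : Measure 𝒳) [IsProbabilityMeasure ν] :
    LipschitzWith 1 fun z : Fin n → 𝒳 => robustWasserstein lam ν (empiricalMeasure z) := by
  refine LipschitzWith.of_le_add fun x y => ?_
  have := isProbabilityMeasure_empiricalMeasure hn x
  have := isProbabilityMeasure_empiricalMeasure hn y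
  refine (robustWasserstein_triangle hlam ν (empiricalMeasure y) _).trans ?_
  gcongr
  exact robustWasserstein_empiricalMeasure_le hlam hn fun i => by
    rw [dist_comm]; exact dist_le_pi_dist x y i

lemma integrable_robustWasserstein_empiricalMeasure (hlam : 0 < lam) {n : ℕ} (hn : 1 ≤ n)
    (ν : Measure 𝒳) [IsProbabilityMeasure ν] (Q : Measure (Fin n → 𝒳)) [IsFiniteMeasure Q] :
    Integrable (fun z => robustWasserstein lam ν (empiricalMeasure z)) Q :=
  Integrable.of_bound
    (lipschitzWith_robustWasserstein_empiricalMeasure hlam hn ν).continuous.aestronglyMeasurable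
    (2 * lam) (ae_of_all _ fun z => by
      have := isProbabilityMeasure_empiricalMeasure hn z
      rw [Real.norm_of_nonneg (robustWasserstein_nonneg hlam _ _)]
      exact robustWasserstein_le_bound hlam _ _)

/-- A countable discretization of the space at scale `δ`, whose cells are unions and differences of
sets with `μ`-null boundary. -/
lemma exists_discretization (μ : Measure 𝒳) [IsProbabilityMeasure μ] {δ : ℝ} (hδ : 0 < δ) :
    ∃ (e : ℕ → 𝒳) (i : 𝒳 → ℕ), Measurable i ∧ (∀ x, dist x (e (i x)) ≤ δ) ∧
      ∀ k, μ (frontier {x | i x < k}) = 0 := by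
  classical
  have : Nonempty 𝒳 := nonempty_of_isProbabilityMeasure μ
  set e := TopologicalSpace.denseSeq 𝒳
  -- The freedom in the radius avoids spheres charged by `μ`; the lower bound δ/2 keeps the balls a
  -- cover.
  have hr (k : ℕ) : ∃ r ∈ Set.Ioo (δ / 2) δ, μ (frontier (Metric.ball (e k) r)) = 0 := by
    simpa using exists_null_frontier_thickening μ {e k} (half_lt_self hδ)
  choose r hr hfr using hr
  have hex (x : 𝒳) : ∃ k, dist x (e k) < r k := by
    obtain ⟨k, hk⟩ := (TopologicalSpace.denseRange_denseSeq 𝒳).exists_dist_lt x (half_pos hδ)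
    exact ⟨k, hk.trans (hr k).1⟩
  -- The index of the first ball containing x, so that `{i < k}` is a finite union of balls.
  refine ⟨e, fun x => Nat.find (hex x),
    measurable_find hex fun k => Metric.isOpen_ball.measurableSet,
    fun x => (Nat.find_spec (hex x)).le.trans (hr _).2.le, fun k => ?_⟩
  induction k with
  | zero => simp
  | succ k ih =>
    have : {x | Nat.find (hex x) < k + 1} =
        {x | Nat.find (hex x) < k} ∪ Metric.ball (e k) (r k) := by
      ext x
      simp only [Nat.find_lt_iff, Set.mem_ofPred_eq, Set.mem_union, Metric.mem_ball]
      constructor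
      · rintro ⟨j, hj, h⟩
        rcases Nat.lt_succ_iff_lt_or_eq.1 hj with h' | rfl
        · exact Or.inl ⟨j, h', h⟩
        · exact Or.inr h
      · rintro (⟨j, hj, h⟩ | h)
        · exact ⟨j, by omega, h⟩
        · exact ⟨k, by omega, h⟩
    rw [this]
    refine measure_mono_null (frontier_union_subset _ _) (measure_union_null ?_ ?_)
    · exact measure_mono_null Set.inter_subset_left ih
    · exact measure_mono_null Set.inter_subset_right (hfr k)

/-- Jensen's inequality: averaging the distance to an empirical measure dominates the distance to
the averaged empirical measure. -/
lemma robustWasserstein_le_expectedRobustWasserstein (hlam : 0 < lam) {n : ℕ} (hn : 1 ≤ n)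
    (ν μ : Measure 𝒳) [IsProbabilityMeasure ν] [IsProbabilityMeasure μ]
    (Q : Measure (Fin n → 𝒳)) [IsProbabilityMeasure Q] (hQ : ∀ i, Q.map (fun z => z i) = μ) :
    robustWasserstein lam ν μ ≤ expectedRobustWasserstein lam ν Q := by
  refine le_of_forall_pos_le_add fun ε hε => ?_
  obtain ⟨e, i, hi, hei, -⟩ := exists_discretization μ (show 0 < ε / 3 by positivity)
  have he : Measurable (e ∘ i) := Measurable.of_discrete.comp hi
  have hJ : Measurable fun (z : Fin n → 𝒳) k => i (z k) :=
    measurable_pi_lambda _ fun k => hi.comp (measurable_pi_apply k)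
  have hemp (z : Fin n → 𝒳) := isProbabilityMeasure_empiricalMeasure hn z
  -- One coupling per rounded sample: these are countably many, so the choice is automatically
  -- measurable. The three ε/3 pay for near-optimality, rounding the sample and rounding `μ`.
  choose π hπ hπ₁ hπ₂ hπ₃ using fun J : Fin n → ℕ =>
    exists_coupling_integral_lt (lt_add_of_pos_right
      (robustWasserstein lam ν (empiricalMeasure (e ∘ J))) (show 0 < ε / 3 by positivity))
  let κ : Kernel (Fin n → 𝒳) (𝒳 × 𝒳) :=
    ⟨fun z => π fun k => i (z k), (Measurable.of_discrete (f := π)).comp hJ⟩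
  have hκ (z : Fin n → 𝒳) : κ z = π fun k => i (z k) := rfl
  have : IsMarkovKernel κ := ⟨fun z => hπ _⟩
  have hfst : Q.bind (Kernel.fst κ) = ν := by
    ext s hs
    rw [Measure.bind_apply hs (Kernel.fst κ).aemeasurable]
    have h (z : Fin n → 𝒳) : Kernel.fst κ z = ν := by
      rw [Kernel.fst_apply, hκ]; exact hπ₁ _
    simp [h]
  have hsnd : Q.bind (Kernel.snd κ) = μ.map (e ∘ i) := by
    ext s hs
    rw [Measure.bind_apply hs (Kernel.snd κ).aemeasurable, Measure.map_apply he hs,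
      ← lintegral_empiricalMeasure_apply hn hQ (he hs)]
    congr 1 with z
    have h : Kernel.snd κ z = (empiricalMeasure z).map (e ∘ i) := by
      rw [Kernel.snd_apply, hκ]
      refine (hπ₂ _).trans ?_
      rw [empiricalMeasure_eq_map, empiricalMeasure_eq_map z, Measure.map_map he .of_discrete]
      rfl
    rw [h, Measure.map_apply he hs]
  have h1 := robustWasserstein_bind_le hlam Q κ
  rw [hfst, hsnd] at h1
  have h2 : ∫ z, ∫ p, trimmedCost lam p ∂κ z ∂Q ≤
      ∫ z, (robustWasserstein lam ν (empiricalMeasure z) + (ε / 3 + ε / 3)) ∂Q := by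
    refine integral_mono_of_nonneg (ae_of_all _ fun z => integral_nonneg (trimmedCost_nonneg hlam))
      ((integrable_robustWasserstein_empiricalMeasure hlam hn ν Q).add (integrable_const _))
      (ae_of_all _ fun z => ?_)
    have h3 := (hπ₃ fun k => i (z k)).le
    have h4 := robustWasserstein_triangle hlam ν (empiricalMeasure z)
      (empiricalMeasure (e ∘ fun k => i (z k)))
    have h5 := robustWasserstein_empiricalMeasure_le hlam hn (x := z) (y := e ∘ fun k => i (z k))
      fun k => hei _
    simp only [hκ]
    linarith
  rw [integral_add (integrable_robustWasserstein_empiricalMeasure hlam hn ν Q)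
    (integrable_const _)] at h2
  have : IsProbabilityMeasure (μ.map (e ∘ i)) := Measure.isProbabilityMeasure_map he.aemeasurable
  have h3 := robustWasserstein_triangle hlam ν (μ.map (e ∘ i)) μ
  have h4 := robustWasserstein_map_le hlam μ he measurable_id (δ := ε / 3) fun x => by
    rw [dist_comm]; exact hei x
  rw [Measure.map_id] at h4
  simp only [integral_const, probReal_univ, one_smul] at h2
  unfold expectedRobustWasserstein
  linarith

/-- Measures with a large common part are close. -/
lemma robustWasserstein_le_of_le (hlam : 0 < lam) {μ ν ρ : Measure 𝒳} [IsProbabilityMeasure μ]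
    [IsProbabilityMeasure ν] (hμ : ρ ≤ μ) (hν : ρ ≤ ν) :
    robustWasserstein lam μ ν ≤ 2 * lam * (1 - ρ Set.univ).toReal := by
  have : IsFiniteMeasure ρ := isFiniteMeasure_of_le μ hμ
  have hα : (μ - ρ) Set.univ = 1 - ρ Set.univ := by
    rw [Measure.sub_apply .univ hμ, measure_univ]
  have hβ : (ν - ρ) Set.univ = 1 - ρ Set.univ := by
    rw [Measure.sub_apply .univ hν, measure_univ]
  set η := 1 - ρ Set.univ with hη
  have hηtop : η ≠ ⊤ := ne_top_of_le_ne_top ENNReal.one_ne_top tsub_le_self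
  have hscale {σ : Measure 𝒳} (hσ : σ Set.univ = η) : (η⁻¹ * η) • σ = σ := by
    rcases eq_or_ne η 0 with h0 | h0
    · rw [Measure.measure_univ_eq_zero.1 (hσ.trans h0), smul_zero]
    · rw [ENNReal.inv_mul_cancel h0 hηtop, one_smul]
  have hdiag : Measurable fun x : 𝒳 => (x, x) := by fun_prop
  -- The common part `ρ` stays on the diagonal at no cost; the remainders, both of mass η, are
  -- coupled independently. If η = 0 the factor is ⊤, but the remainders vanish.
  set π := η⁻¹ • (μ - ρ).prod (ν - ρ) with hπ
  have hfst : π.fst = μ - ρ := by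
    rw [hπ, Measure.fst, Measure.map_smul, Measure.map_fst_prod, hβ, smul_smul, hscale hα]
  have hsnd : π.snd = ν - ρ := by
    rw [hπ, Measure.snd, Measure.map_smul, Measure.map_snd_prod, hα, smul_smul, hscale hβ]
  have hπuniv : π Set.univ = η := by rw [← Measure.fst_univ, hfst, hα]
  have : IsFiniteMeasure π := ⟨by rw [hπuniv]; exact hηtop.lt_top⟩
  refine (robustWasserstein_le_integral hlam (π := ρ.map (fun x => (x, x)) + π) ?_ ?_).trans ?_
  · rw [Measure.fst_add, hfst, Measure.fst_map_prodMk measurable_id']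
    simp [add_comm ρ, Measure.sub_add_cancel_of_le hμ]
  · rw [Measure.snd_add, hsnd, Measure.snd_map_prodMk measurable_id']
    simp [add_comm ρ, Measure.sub_add_cancel_of_le hν]
  · rw [integral_add_measure (integrable_trimmedCost hlam _) (integrable_trimmedCost hlam _),
      integral_map hdiag.aemeasurable measurable_trimmedCost.aestronglyMeasurable]
    simp only [trimmedCost_self hlam, integral_zero, zero_add]
    calc ∫ p, trimmedCost lam p ∂π ≤ ∫ _, 2 * lam ∂π :=
          integral_mono (integrable_trimmedCost hlam _) (integrable_const _) trimmedCost_le_bound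
      _ = 2 * lam * η.toReal := by simp [Measure.real, hπuniv, mul_comm]

/-- Push-forwards of measures on `ℕ` are close when the masses of the atoms are. -/
lemma robustWasserstein_map_nat_le (hlam : 0 < lam) (p q : Measure ℕ) [IsProbabilityMeasure p]
    [IsProbabilityMeasure q] (e : ℕ → 𝒳) :
    robustWasserstein lam (p.map e) (q.map e) ≤
      2 * lam * (1 - ∑' k, min (p {k}) (q {k})).toReal := by
  have he : Measurable e := .of_discrete
  have := Measure.isProbabilityMeasure_map (μ := p) he.aemeasurable
  have := Measure.isProbabilityMeasure_map (μ := q) he.aemeasurable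
  set ρ : Measure ℕ := Measure.sum fun k => min (p {k}) (q {k}) • Measure.dirac k with hρ
  have hle {σ : Measure ℕ} (h : ∀ k, min (p {k}) (q {k}) ≤ σ {k}) : ρ ≤ σ := by
    rw [← Measure.sum_smul_dirac σ, hρ]
    refine Measure.le_iff.2 fun s hs => ?_
    rw [Measure.sum_apply _ hs, Measure.sum_apply _ hs]
    exact ENNReal.tsum_le_tsum fun k => by
      simp only [Measure.smul_apply, smul_eq_mul]
      gcongr
      exact h k
  have h := robustWasserstein_le_of_le hlam (ρ := ρ.map e)
    (Measure.map_mono (hle fun k => min_le_left _ _) he)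
    (Measure.map_mono (hle fun k => min_le_right _ _) he)
  rw [Measure.map_apply he .univ, Set.preimage_univ] at h
  convert h using 4
  simp [hρ]

/-- Weak convergence implies convergence in the robust Wasserstein distance. -/
lemma tendsto_robustWasserstein_of_tendsto (hlam : 0 < lam) {ι : Type*} {l : Filter ι}
    [l.IsCountablyGenerated] {μs : ι → ProbabilityMeasure 𝒳} {μ : ProbabilityMeasure 𝒳}
    (h : Tendsto μs l (𝓝 μ)) :
    Tendsto (fun n => robustWasserstein lam (μs n : Measure 𝒳) (μ : Measure 𝒳)) l (𝓝 0) := by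
  refine tendsto_order.2 ⟨fun a ha => Eventually.of_forall fun n =>
    ha.trans_le (robustWasserstein_nonneg hlam _ _), fun ε hε => ?_⟩
  obtain ⟨e, i, hi, hei, hfr⟩ := exists_discretization (μ : Measure 𝒳)
    (show 0 < ε / 3 by positivity)
  have hp (σ : ProbabilityMeasure 𝒳) : IsProbabilityMeasure ((σ : Measure 𝒳).map i) :=
    Measure.isProbabilityMeasure_map hi.aemeasurable
  have hcum (k : ℕ) : Tendsto (fun n => (μs n : Measure 𝒳) {x | i x < k}) l
      (𝓝 ((μ : Measure 𝒳) {x | i x < k})) :=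
    ProbabilityMeasure.tendsto_measure_of_null_frontier_of_tendsto' h (hfr k)
  have hcell (σ : ProbabilityMeasure 𝒳) (k : ℕ) : (σ : Measure 𝒳).map i {k} =
      (σ : Measure 𝒳) {x | i x < k + 1} - (σ : Measure 𝒳) {x | i x < k} := by
    rw [Measure.map_apply hi (measurableSet_singleton k), ← measure_sdiff
      (show {x | i x < k} ⊆ {x | i x < k + 1} from fun x (hx : i x < k) => Nat.lt_succ_of_lt hx)
      (hi (measurableSet_Iio (a := k))).nullMeasurableSet (measure_ne_top _ _)]
    congr 1
    ext x
    simp only [Set.mem_preimage, Set.mem_singleton_iff, Set.mem_sdiff, Set.mem_ofPred_eq]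
    omega
  have hatom (k : ℕ) : Tendsto (fun n => (μs n : Measure 𝒳).map i {k}) l
      (𝓝 ((μ : Measure 𝒳).map i {k})) := by
    simp only [hcell]
    exact ENNReal.Tendsto.sub (hcum (k + 1)) (hcum k) (Or.inl (measure_ne_top _ _))
  have hone : ∑' k, (μ : Measure 𝒳).map i {k} = 1 := by
    have := hp μ
    rw [← measure_univ (μ := (μ : Measure 𝒳).map i), ← Set.iUnion_of_singleton ℕ,
      measure_iUnion (fun a b hab => by simpa using hab) fun k => measurableSet_singleton k]
  -- Scheffé's argument: the minima are dominated by the summable limit masses, so the overlap tends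
  -- to 1.
  have hsum : Tendsto (fun n => ∑' k, min ((μs n : Measure 𝒳).map i {k})
      ((μ : Measure 𝒳).map i {k})) l (𝓝 1) := by
    rw [← hone]
    simp only [← lintegral_count]
    refine tendsto_lintegral_filter_of_dominated_convergence
      (fun k => (μ : Measure 𝒳).map i {k}) (Eventually.of_forall fun _ => .of_discrete)
      (Eventually.of_forall fun _ => ae_of_all _ fun _ => min_le_right _ _)
      (by rw [lintegral_count, hone]; exact ENNReal.one_ne_top) (ae_of_all _ fun k => ?_)
    simpa using (hatom k).min (tendsto_const_nhds (x := (μ : Measure 𝒳).map i {k}))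
  have hlim : Tendsto (fun n => 2 * lam * (1 - ∑' k, min ((μs n : Measure 𝒳).map i {k})
      ((μ : Measure 𝒳).map i {k})).toReal) l (𝓝 0) := by
    have h1 := ENNReal.Tendsto.sub (tendsto_const_nhds (x := (1 : ENNReal))) hsum
      (Or.inl ENNReal.one_ne_top)
    rw [tsub_self] at h1
    simpa using ((ENNReal.tendsto_toReal ENNReal.zero_ne_top).comp h1).const_mul (2 * lam)
  filter_upwards [hlim.eventually (gt_mem_nhds (show 0 < ε / 3 by positivity))] with n hn
  have he : Measurable (e ∘ i) := Measurable.of_discrete.comp hi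
  have hp' (σ : ProbabilityMeasure 𝒳) : IsProbabilityMeasure ((σ : Measure 𝒳).map (e ∘ i)) :=
    Measure.isProbabilityMeasure_map he.aemeasurable
  have := hp μ
  have := hp (μs n)
  have h1 := robustWasserstein_map_nat_le hlam ((μs n : Measure 𝒳).map i) ((μ : Measure 𝒳).map i) e
  rw [Measure.map_map .of_discrete hi, Measure.map_map .of_discrete hi] at h1
  have h2 := robustWasserstein_triangle hlam (μs n : Measure 𝒳) ((μs n : Measure 𝒳).map (e ∘ i)) μ
  have h3 := robustWasserstein_triangle hlam ((μs n : Measure 𝒳).map (e ∘ i))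
    ((μ : Measure 𝒳).map (e ∘ i)) μ
  have h4 := robustWasserstein_map_le hlam (μs n : Measure 𝒳) measurable_id he hei
  have h5 := robustWasserstein_map_le hlam (μ : Measure 𝒳) he measurable_id (δ := ε / 3) fun x => by
    rw [dist_comm]; exact hei x
  rw [Measure.map_id] at h4 h5
  linarith

end WeakConvergence

/-! ### Continuous convergence and minimizers -/

/-- Along a subsequence the first coordinates increase strictly; the second coordinates then extend
to a full sequence by putting x at the missing indices. -/
lemma tendsto_atTop_prod_nhds_of_seq {T S : Type*} [TopologicalSpace T] [FirstCountableTopology T]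
    {g : ℕ → T → S} {l : Filter S} {x : T}
    (h : ∀ t : ℕ → T, Tendsto t atTop (𝓝 x) → Tendsto (fun n => g n (t n)) atTop l) :
    Tendsto (fun p : ℕ × T => g p.1 p.2) (atTop ×ˢ 𝓝 x) l := by
  refine tendsto_of_subseq_tendsto fun u hu => ?_
  obtain ⟨φ, hφ, hψ⟩ := strictMono_subseq_of_tendsto_atTop (tendsto_fst.comp hu)
  have hs : Tendsto (fun j => (u (φ j)).2) atTop (𝓝 x) :=
    (tendsto_snd.comp hu).comp hφ.tendsto_atTop
  set ψ : ℕ → ℕ := fun j => (u (φ j)).1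
  have hψ : StrictMono ψ := hψ
  set t : ℕ → T := Function.extend ψ (fun j => (u (φ j)).2) fun _ => x
  have htψ (j : ℕ) : t (ψ j) = (u (φ j)).2 := hψ.injective.extend_apply _ _ _
  have ht : Tendsto t atTop (𝓝 x) := by
    refine tendsto_def.2 fun U hU => ?_
    obtain ⟨J, hJ⟩ := eventually_atTop.1 (hs.eventually hU)
    filter_upwards [eventually_ge_atTop (ψ J)] with n hn
    by_cases hr : ∃ j, ψ j = n
    · obtain ⟨j, rfl⟩ := hr
      rw [Set.mem_preimage, htψ]
      exact hJ j (hψ.le_iff_le.1 hn)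
    · rw [Set.mem_preimage, show t n = x from Function.extend_apply' _ _ _ hr]
      exact mem_of_mem_nhds hU
  refine ⟨φ, ((h t ht).comp hψ.tendsto_atTop).congr fun j => ?_⟩
  simp only [Function.comp_apply, htψ]
  rfl

/-- Convergence of infima and minimizers for functions that converge continuously and are
asymptotically bounded below by their limit, when the limit has a compact set of near-minimizers. -/
lemma tendsto_iInf_and_argminSet {E : Type*} [MetricSpace E] [ProperSpace E] {Θ : Set E}
    (hΘ : Θ.Nonempty) {f : Θ → ℝ} {F : ℕ → Θ → ℝ} {a : ℕ → ℝ} (hf : BddBelow (Set.range f))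
    (ha : Tendsto a atTop (𝓝 0)) (hlow : ∀ᶠ n in atTop, ∀ θ, f θ - a n ≤ F n θ)
    (hcont : ∀ᶠ n in atTop, Continuous (F n))
    (hconv : ∀ θ, Tendsto (fun p : ℕ × Θ => F p.1 p.2) (atTop ×ˢ 𝓝 θ) (𝓝 (f θ)))
    {ε : ℝ} (hε : 0 < ε) (hbdd : Bornology.IsBounded (nearArgminSet f ε))
    (hclos : closure (nearArgminSet f ε) ⊆ Θ) :
    Tendsto (fun n => ⨅ θ, F n θ) atTop (𝓝 (⨅ θ, f θ)) ∧
    (∃ N, (∀ n, N ≤ n → (argminSet (F n)).Nonempty) ∧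
      Bornology.IsBounded (⋃ n, ⋃ (_ : N ≤ n), argminSet (F n))) ∧
    outerLimit (fun n => argminSet (F n)) ⊆ argminSet f := by
  have : Nonempty Θ := hΘ.to_subtype
  have hinf (θ : Θ) : ⨅ θ, f θ ≤ f θ := ciInf_le hf θ
  have hFbdd {n : ℕ} (hn : ∀ θ, f θ - a n ≤ F n θ) : BddBelow (Set.range (F n)) := by
    refine ⟨(⨅ θ, f θ) - a n, ?_⟩
    rintro _ ⟨θ, rfl⟩
    linarith [hn θ, hinf θ]
  have hpt (θ : Θ) : Tendsto (fun n => F n θ) atTop (𝓝 (f θ)) :=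
    (hconv θ).comp (tendsto_id.prodMk tendsto_const_nhds)
  have hlim : Tendsto (fun n => ⨅ θ, F n θ) atTop (𝓝 (⨅ θ, f θ)) := by
    refine tendsto_order.2 ⟨fun b hb => ?_, fun b hb => ?_⟩
    · filter_upwards [hlow, ha.eventually (gt_mem_nhds (sub_pos.2 hb))] with n hn han
      refine lt_of_lt_of_le (b := (⨅ θ, f θ) - a n) (by linarith) (le_ciInf fun θ => ?_)
      linarith [hn θ, hinf θ]
    · obtain ⟨θ, hθ⟩ := exists_lt_of_ciInf_lt hb
      filter_upwards [hlow, (hpt θ).eventually (gt_mem_nhds hθ)] with n hn hlt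
      exact (ciInf_le (hFbdd hn) θ).trans_lt hlt
  have hmem : ∀ᶠ n in atTop, ∀ θ : Θ, F n θ ≤ (⨅ θ, f θ) + ε / 2 → (θ : E) ∈ nearArgminSet f ε := by
    filter_upwards [hlow, ha.eventually (gt_mem_nhds (half_pos hε))] with n hn han θ hθ
    exact ⟨θ, rfl, by linarith [hn θ]⟩
  have hinflt : ∀ᶠ n in atTop, ⨅ θ, F n θ < (⨅ θ, f θ) + ε / 2 :=
    hlim.eventually (gt_mem_nhds (by linarith))
  have hmin : ∀ᶠ n in atTop, argminSet (F n) ⊆ nearArgminSet f ε := by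
    filter_upwards [hmem, hinflt, hlow] with n h1 h2 h3
    rintro _ ⟨θ, rfl, hθ⟩
    exact h1 θ ((le_ciInf hθ).trans h2.le)
  have hex : ∀ᶠ n in atTop, (argminSet (F n)).Nonempty := by
    filter_upwards [hmem, hinflt, hcont] with n h1 h2 h3
    have hK : IsCompact (Subtype.val ⁻¹' closure (nearArgminSet f ε) : Set Θ) := by
      rw [Subtype.isCompact_iff, Subtype.image_preimage_coe, Set.inter_eq_right.2 hclos]
      exact hbdd.isCompact_closure
    obtain ⟨θ₀, hθ₀⟩ := exists_lt_of_ciInf_lt h2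
    obtain ⟨θ, -, hθ⟩ := hK.exists_isMinOn ⟨θ₀, subset_closure (h1 θ₀ hθ₀.le)⟩ h3.continuousOn
    refine ⟨θ, θ, rfl, fun θ' => ?_⟩
    -- Compactness settles the sublevel set; any point outside it already loses to `θ₀`.
    by_cases h : F n θ' ≤ (⨅ θ, f θ) + ε / 2
    · exact hθ (subset_closure (h1 θ' h))
    · exact (hθ (subset_closure (h1 θ₀ hθ₀.le))).trans (hθ₀.trans (not_le.1 h)).le
  refine ⟨hlim, ?_, ?_⟩
  · obtain ⟨N, hN⟩ := eventually_atTop.1 (hex.and hmin)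
    refine ⟨N, fun n hn => (hN n hn).1, hbdd.subset ?_⟩
    simp only [Set.iUnion_subset_iff]
    exact fun n hn => (hN n hn).2
  · rintro x ⟨φ, hφ, y, hy, hyx⟩
    -- The limit must lie in Θ before continuous convergence can be applied there.
    have hxΘ : x ∈ Θ := hclos <| mem_closure_of_tendsto hyx <| by
      filter_upwards [hφ.tendsto_atTop.eventually hmin] with k hk using hk (hy k)
    choose t hty ht using hy
    have htx : Tendsto t atTop (𝓝 ⟨x, hxΘ⟩) := by
      rw [tendsto_subtype_rng]
      simpa [hty] using hyx
    have h1 : Tendsto (fun k => F (φ k) (t k)) atTop (𝓝 (f ⟨x, hxΘ⟩)) :=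
      (hconv ⟨x, hxΘ⟩).comp (hφ.tendsto_atTop.prodMk htx)
    have h2 : Tendsto (fun k => F (φ k) (t k)) atTop (𝓝 (⨅ θ, f θ)) := by
      refine (hlim.comp hφ.tendsto_atTop).congr' ?_
      filter_upwards [hφ.tendsto_atTop.eventually hlow] with k hk
      exact le_antisymm (ciInf_le (hFbdd hk) _) (le_ciInf (ht k))
    refine ⟨⟨x, hxΘ⟩, rfl, fun θ' => ?_⟩
    rw [tendsto_nhds_unique h1 h2]
    exact hinf θ'

/-! ### The expected distance as an objective function -/

section Expectation

variable {𝒳 : Type*} [MetricSpace 𝒳] [PolishSpace 𝒳] [MeasurableSpace 𝒳] [BorelSpace 𝒳]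
  {lam : ℝ}

lemma expectedRobustWasserstein_le_add (hlam : 0 < lam) {n : ℕ} (hn : 1 ≤ n) (ν μ : Measure 𝒳)
    [IsProbabilityMeasure ν] [IsProbabilityMeasure μ] (Q : Measure (Fin n → 𝒳))
    [IsProbabilityMeasure Q] :
    expectedRobustWasserstein lam ν Q ≤
      robustWasserstein lam ν μ + expectedRobustWasserstein lam μ Q := by
  have h := integral_mono (integrable_robustWasserstein_empiricalMeasure hlam hn ν Q)
    ((integrable_const (robustWasserstein lam ν μ)).add
      (integrable_robustWasserstein_empiricalMeasure hlam hn μ Q)) fun z => by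
    have := isProbabilityMeasure_empiricalMeasure hn z
    exact robustWasserstein_triangle hlam ν μ (empiricalMeasure z)
  refine h.trans_eq ?_
  rw [integral_add' (integrable_const _)
    (integrable_robustWasserstein_empiricalMeasure hlam hn μ Q)]
  simp [expectedRobustWasserstein]

/-- The upper half is the triangle inequality through `μ`, the lower half is Jensen. Each term on
the right vanishes in the limit by a different assumption. -/
lemma abs_expectedRobustWasserstein_sub_le (hlam : 0 < lam) {n : ℕ} (hn : 1 ≤ n)
    (ν ν' μ μ' : Measure 𝒳) [IsProbabilityMeasure ν] [IsProbabilityMeasure ν']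
    [IsProbabilityMeasure μ] [IsProbabilityMeasure μ'] (Q : Measure (Fin n → 𝒳))
    [IsProbabilityMeasure Q] (hQ : ∀ i, Q.map (fun z => z i) = μ) :
    |expectedRobustWasserstein lam ν Q - robustWasserstein lam ν' μ'| ≤
      robustWasserstein lam ν ν' + expectedRobustWasserstein lam μ Q +
        robustWasserstein lam μ μ' := by
  have h1 := robustWasserstein_le_expectedRobustWasserstein hlam hn ν μ Q hQ
  have h2 := expectedRobustWasserstein_le_add hlam hn ν μ Q
  have h3 := robustWasserstein_triangle hlam ν ν' μ
  have h4 := robustWasserstein_triangle hlam ν' μ' μ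
  have h5 := robustWasserstein_triangle hlam ν' ν μ'
  have h6 := robustWasserstein_triangle hlam ν μ μ'
  have h7 : 0 ≤ expectedRobustWasserstein lam μ Q :=
    integral_nonneg fun z => robustWasserstein_nonneg hlam _ _
  rw [robustWasserstein_comm hlam ν' ν] at h5
  rw [robustWasserstein_comm hlam μ' μ] at h4
  rw [abs_le]
  constructor <;> linarith

lemma continuous_expectedRobustWasserstein (hlam : 0 < lam) {n : ℕ} (hn : 1 ≤ n)
    (ν : Measure 𝒳) [IsProbabilityMeasure ν] :
    Continuous fun Q : ProbabilityMeasure (Fin n → 𝒳) =>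
      expectedRobustWasserstein lam ν (Q : Measure (Fin n → 𝒳)) := by
  let g : BoundedContinuousFunction (Fin n → 𝒳) ℝ := BoundedContinuousFunction.ofNormedAddCommGroup
    (fun z => robustWasserstein lam ν (empiricalMeasure z))
    (lipschitzWith_robustWasserstein_empiricalMeasure hlam hn ν).continuous (2 * lam) fun z => by
      have := isProbabilityMeasure_empiricalMeasure hn z
      rw [Real.norm_of_nonneg (robustWasserstein_nonneg hlam _ _)]
      exact robustWasserstein_le_bound hlam _ _
  exact continuous_iff_continuousAt.2 fun Q =>
    ProbabilityMeasure.tendsto_iff_forall_integral_tendsto.1 tendsto_id g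

end Expectation

end RobustWasserstein

/-! ### The main theorem -/

open RobustWasserstein in
theorem theorem8
    -- the sample space, the data, and the limit of the empirical measures
    {𝒳 : Type*} [MetricSpace 𝒳] [PolishSpace 𝒳] [MeasurableSpace 𝒳] [BorelSpace 𝒳]
    {Ω : Type*} [MeasurableSpace Ω] (P : Measure Ω) [IsProbabilityMeasure P]
    (X : ℕ → Ω → 𝒳) (hX : ∀ i, Measurable (X i))
    (μstar : ProbabilityMeasure 𝒳)
    (lam : ℝ) (hlam : 0 < lam)
    -- the parameter set, with a distance that induces its usual topology
    {d : ℕ} (Θ : Set (EuclideanSpace ℝ (Fin d))) (hΘ : Θ.Nonempty)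
    (ρ : MetricSpace Θ)
    (hρ : ρ.toPseudoMetricSpace.toUniformSpace.toTopologicalSpace = instTopologicalSpaceSubtype)
    -- the model: joint laws of samples of every size, with one-dimensional marginals `μ θ`
    (μ : Θ → ProbabilityMeasure 𝒳)
    (μs : (m : ℕ) → Θ → ProbabilityMeasure (Fin m → 𝒳))
    (hmarg : ∀ (m : ℕ) (θ : Θ) (i : Fin m),
      (μs m θ : Measure (Fin m → 𝒳)).map (fun z => z i) = (μ θ : Measure 𝒳))
    -- the size of the synthetic sample
    (m : ℕ → ℕ) (hm : Tendsto m atTop atTop)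
    -- almost sure convergence of the empirical measures of the data
    (h1 : ∀ᵐ ω ∂P, Tendsto
      (fun n : ℕ => robustWasserstein lam (empiricalMeasure fun i : Fin n => X i ω)
        (μstar : Measure 𝒳))
      atTop (𝓝 0))
    -- weak continuity of the limiting model
    (h2 : ∀ (t : ℕ → Θ) (θ : Θ),
      Tendsto (fun n => ρ.toPseudoMetricSpace.toDist.dist (t n) θ) atTop (𝓝 0) →
      Tendsto (fun n => μ (t n)) atTop (𝓝 (μ θ)))
    -- some near-minimizing set is bounded, and closed up inside `Θ`
    (h3 : ∃ ε : ℝ, 0 < ε ∧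
      Bornology.IsBounded (nearArgminSet (fun θ : Θ =>
        robustWasserstein lam (μstar : Measure 𝒳) (μ θ : Measure 𝒳)) ε) ∧
      closure (nearArgminSet (fun θ : Θ =>
        robustWasserstein lam (μstar : Measure 𝒳) (μ θ : Measure 𝒳)) ε) ⊆ Θ)
    -- weak continuity of the model for every sample size
    (h4 : ∀ k : ℕ, 1 ≤ k → ∀ (t : ℕ → Θ) (θ : Θ),
      Tendsto (fun n => ρ.toPseudoMetricSpace.toDist.dist (t n) θ) atTop (𝓝 0) →
      Tendsto (fun n => μs k (t n)) atTop (𝓝 (μs k θ)))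
    -- locally uniform convergence of the empirical measures of the model
    (h5 : ∀ (t : ℕ → Θ) (θ : Θ),
      Tendsto (fun n => ρ.toPseudoMetricSpace.toDist.dist (t n) θ) atTop (𝓝 0) →
      Tendsto (fun n => expectedRobustWasserstein lam (μ (t n) : Measure 𝒳)
        (μs n (t n) : Measure (Fin n → 𝒳))) atTop (𝓝 0)) :
    ∃ A : Set Ω, MeasurableSet A ∧ P A = 1 ∧ ∀ ω ∈ A,
      Tendsto (fun n : ℕ => ⨅ θ : Θ, expectedRobustWasserstein lam
          (empiricalMeasure fun i : Fin n => X i ω) (μs (m n) θ : Measure (Fin (m n) → 𝒳)))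
        atTop (𝓝 (⨅ θ : Θ, robustWasserstein lam (μstar : Measure 𝒳) (μ θ : Measure 𝒳))) ∧
      (∃ N : ℕ,
        (∀ n, N ≤ n → (argminSet fun θ : Θ => expectedRobustWasserstein lam
          (empiricalMeasure fun i : Fin n => X i ω)
          (μs (m n) θ : Measure (Fin (m n) → 𝒳))).Nonempty) ∧
        Bornology.IsBounded (⋃ n, ⋃ (_ : N ≤ n), argminSet fun θ : Θ =>
          expectedRobustWasserstein lam (empiricalMeasure fun i : Fin n => X i ω)
            (μs (m n) θ : Measure (Fin (m n) → 𝒳)))) ∧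
      outerLimit (fun n : ℕ => argminSet fun θ : Θ => expectedRobustWasserstein lam
          (empiricalMeasure fun i : Fin n => X i ω) (μs (m n) θ : Measure (Fin (m n) → 𝒳))) ⊆
        argminSet fun θ : Θ => robustWasserstein lam (μstar : Measure 𝒳) (μ θ : Measure 𝒳) := by
  have hseq {t : ℕ → Θ} {θ : Θ} (h : Tendsto t atTop (𝓝 θ)) :
      Tendsto (fun n => ρ.toPseudoMetricSpace.toDist.dist (t n) θ) atTop (𝓝 0) := by
    rw [← hρ] at h
    exact (@tendsto_iff_dist_tendsto_zero _ _ ρ.toPseudoMetricSpace _ _ _).1 h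
  obtain ⟨ε, hε, hbdd, hclos⟩ := h3
  have hμcont (θ : Θ) : Tendsto (fun θ' =>
      robustWasserstein lam (μ θ' : Measure 𝒳) (μ θ : Measure 𝒳)) (𝓝 θ) (𝓝 0) :=
    tendsto_robustWasserstein_of_tendsto hlam <| tendsto_of_seq_tendsto fun t ht =>
      h2 t θ (hseq ht)
  have hμscont {k : ℕ} (hk : 1 ≤ k) : Continuous (μs k) :=
    continuous_iff_continuousAt.2 fun θ => tendsto_of_seq_tendsto fun t ht => h4 k hk t θ (hseq ht)
  -- Since `m` may repeat or skip values, `h5` does not apply to sequences indexed by n; its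
  -- product-filter form composes with `m`.
  have hunif (θ : Θ) : Tendsto (fun p : ℕ × Θ => expectedRobustWasserstein lam
      (μ p.2 : Measure 𝒳) (μs (m p.1) p.2 : Measure (Fin (m p.1) → 𝒳))) (atTop ×ˢ 𝓝 θ) (𝓝 0) :=
    (tendsto_atTop_prod_nhds_of_seq (g := fun k θ' => expectedRobustWasserstein lam
      (μ θ' : Measure 𝒳) (μs k θ' : Measure (Fin k → 𝒳))) fun t ht => h5 t θ (hseq ht)).comp
      (hm.prodMap tendsto_id)
  -- The empirical measure of an empty sample is zero, so size 0 is discarded on both sides.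
  have hpos : ∀ᶠ n in atTop, 1 ≤ n ∧ 1 ≤ m n :=
    (eventually_ge_atTop 1).and (hm.eventually_ge_atTop 1)
  obtain ⟨A, hA, hAmeas, hAlim⟩ := Eventually.exists_measurable_mem h1
  refine ⟨A, hAmeas, prob_compl_eq_zero_iff hAmeas |>.1 (mem_ae_iff.1 hA), fun ω hω => ?_⟩
  have hlim := hAlim ω hω
  refine tendsto_iInf_and_argminSet hΘ
    ⟨0, by rintro _ ⟨θ, rfl⟩; exact robustWasserstein_nonneg hlam _ _⟩ hlim ?_ ?_ ?_ hε hbdd hclos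
  · filter_upwards [hpos] with n ⟨hn, hmn⟩ θ
    have := isProbabilityMeasure_empiricalMeasure hn fun i : Fin n => X i ω
    have h6 := robustWasserstein_le_expectedRobustWasserstein hlam hmn
      (empiricalMeasure fun i : Fin n => X i ω) (μ θ : Measure 𝒳) (μs (m n) θ) (hmarg (m n) θ)
    have h7 := robustWasserstein_triangle hlam (μstar : Measure 𝒳)
      (empiricalMeasure fun i : Fin n => X i ω) (μ θ : Measure 𝒳)
    rw [robustWasserstein_comm hlam (μstar : Measure 𝒳)
      (empiricalMeasure fun i : Fin n => X i ω)] at h7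
    linarith
  · filter_upwards [hpos] with n ⟨hn, hmn⟩
    have := isProbabilityMeasure_empiricalMeasure hn fun i : Fin n => X i ω
    exact (continuous_expectedRobustWasserstein hlam hmn _).comp (hμscont hmn)
  · intro θ
    rw [tendsto_iff_dist_tendsto_zero]
    refine squeeze_zero' (Eventually.of_forall fun _ => dist_nonneg)
      ?_ (by simpa using ((hlim.comp tendsto_fst).add (hunif θ)).add ((hμcont θ).comp tendsto_snd))
    filter_upwards [tendsto_fst.eventually hpos] with p ⟨hn, hmn⟩
    have := isProbabilityMeasure_empiricalMeasure hn fun i : Fin p.1 => X i ω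
    exact abs_expectedRobustWasserstein_sub_le hlam hmn _ _ _ _ _ (hmarg (m p.1) p.2)
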